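/- Let $\Omega$ be a set. An $\Omega$-decorated rooted forest is a finite (possibly empty, non-planar) forest of rooted trees whose vertices carry elements of $\Omega$; forests form a commutative monoid under disjoint union, with unit the empty forest $\emptyset$. For $\omega\in\Omega$, $B_+^\omega(F)$ is the tree obtained by grafting all the trees of $F$ on a new root decorated by $\omega$. A branching vertex is a vertex with at least two direct successors, and a ladder tree is a tree $B_+^{\omega_1}\circ\cdots\circ B_+^{\omega_k}(\emptyset)$, $k\ge 1$. Let $\mathbb{N}^*=\mathbb{Z}_{\ge1}$. For $N\in\mathbb{N}$ and an $\mathbb{N}^*$-decorated forest $F$ define $\mathcal{Z}_F(N)\in\mathbb{R}$ recursively by $$\mathcal{Z}_\emptyset(N)=1,\qquad \mathcal{Z}_{FG}(N)=\mathcal{Z}_F(N)\,\mathcal{Z}_G(N),\qquad \mathcal{Z}_{B_+^{s}(F)}(N)=\sum_{1\le n<N} n^{-s}\,\mathcal{Z}_F(n),$$ and set $\zeta^T_{\text{stuffle}}(F):=\lim_{N\to\infty}\mathcal{Z}_F(N)$. Let $\sigma_x(t)=1/t$ and $\sigma_y(t)=1/(1-t)$. For $0<\varepsilon\le z<1$ and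 an $\{x,y\}$-decorated forest $F$ define $I_F(\varepsilon,z)$ by $$I_\emptyset(\varepsilon,z)=1,\qquad I_{FG}(\varepsilon,z)=I_F(\varepsilon,z)\,I_G(\varepsilon,z),\qquad I_{B_+^{a}(F)}(\varepsilon,z)=\int_\varepsilon^z\sigma_a(t)\,I_F(\varepsilon,t)\,dt,$$ and set $\mathrm{Li}^T_F(z):=\lim_{\varepsilon\to0^+}I_F(\varepsilon,z)$ and $\zeta^T_{\text{shuffle}}(F):=\lim_{z\to1^-}\mathrm{Li}^T_F(z)$. The branched binarisation map $\mathfrak{s}^T$ sends $\mathbb{N}^*$-decorated forests to $\{x,y\}$-decorated forests and is determined by $\mathfrak{s}^T(\emptyset)=\emptyset$, $\mathfrak{s}^T(FG)=\mathfrak{s}^T(F)\,\mathfrak{s}^T(G)$ and $\mathfrak{s}^T(B_+^n(F))=(B_+^x)^{n-1}\bigl(B_+^y(\mathfrak{s}^T(F))\bigr)$ for $n\ge1$. An $\mathbb{N}^*$-decorated forest is convergent if each of its roots has a decoration $\ge2$. **Theorem.** Let $F$ be a convergent $\mathbb{N}^*$-decorated forest. Then the limits defining $\zeta^T_{\text{stuffle}}(F)$,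 $\mathrm{Li}^T_{\mathfrak{s}^T(F)}(z)$ for every $z\in\,]0,1[$, and $\zeta^T_{\text{shuffle}}(\mathfrak{s}^T(F))$ exist and are finite, and $$\zeta^T_{\text{shuffle}}(\mathfrak{s}^T(F))\le\zeta^T_{\text{stuffle}}(F).$$ Equality holds if and only if $F$ has no branching vertex; and $F$ has no branching vertex if and only if $F$ is empty or a product $l_1\cdots l_k$ of ladder trees. -/

import Mathlib

open Filter Topology

namespace ArborifiedZeta

universe u v

/-- Ordered (planar) `Ω`-decorated rooted forests: `nil` is the empty forest, and `cons ω F G` is the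
forest whose first tree has a root decorated by `ω` with the trees of `F` grafted on it, and whose
remaining trees are those of `G`. -/
inductive PlanarForest (Ω : Type u) : Type u
  | nil : PlanarForest Ω
  | cons (ω : Ω) (F G : PlanarForest Ω) : PlanarForest Ω

namespace PlanarForest

variable {Ω : Type u}

/-- One exchange of two neighbouring trees, at the top of the forest or above any vertex. -/
inductive Swap : PlanarForest Ω → PlanarForest Ω → Prop
  | swap (ω₁ : Ω) (F₁ : PlanarForest Ω) (ω₂ : Ω) (F₂ G : PlanarForest Ω) :
      Swap (cons ω₁ F₁ (cons ω₂ F₂ G)) (cons ω₂ F₂ (cons ω₁ F₁ G))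
  | above (ω : Ω) {F F' : PlanarForest Ω} (G : PlanarForest Ω) (h : Swap F F') :
      Swap (cons ω F G) (cons ω F' G)
  | tail (ω : Ω) (F : PlanarForest Ω) {G G' : PlanarForest Ω} (h : Swap G G') :
      Swap (cons ω F G) (cons ω F G')

/-- Concatenation of planar forests. -/
def append : PlanarForest Ω → PlanarForest Ω → PlanarForest Ω
  | nil, H => H
  | cons ω F G, H => cons ω F (append G H)

/-- The decorations of the roots, with multiplicity. -/
def roots : PlanarForest Ω → Multiset Ω
  | nil => 0
  | cons ω _ G => ω ::ₘ roots G

/-- The multiset, over all the vertices, of the number of direct successors of the vertex. -/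
def outDegrees : PlanarForest Ω → Multiset ℕ
  | nil => 0
  | cons _ F G => F.roots.card ::ₘ (outDegrees F + outDegrees G)

/-- Evaluation of a planar forest in a commutative monoid `A` on which `Ω` operates by `β`. -/
def eval {A : Type v} [CommMonoid A] (β : Ω → A → A) : PlanarForest Ω → A
  | nil => 1
  | cons ω F G => β ω (eval β F) * eval β G

theorem roots_congr {F F' : PlanarForest Ω} (h : Swap F F') : F.roots = F'.roots := by
  induction h with
  | swap => exact Multiset.cons_swap _ _ _
  | above ω G h ih => rfl
  | tail ω F h ih => simp only [roots, ih]

theorem outDegrees_congr {F F' : PlanarForest Ω} (h : Swap F F') :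
    F.outDegrees = F'.outDegrees := by
  induction h with
  | swap ω₁ F₁ ω₂ F₂ G =>
    simp only [outDegrees, ← Multiset.singleton_add]
    abel
  | above ω G h ih => simp only [outDegrees, ih, roots_congr h]
  | tail ω F h ih => simp only [outDegrees, ih]

theorem eval_congr {A : Type v} [CommMonoid A] (β : Ω → A → A) {F F' : PlanarForest Ω}
    (h : Swap F F') : F.eval β = F'.eval β := by
  induction h with
  | swap ω₁ F₁ ω₂ F₂ G => simp only [eval]; exact mul_left_comm _ _ _
  | above ω G h ih => simp only [eval, ih]
  | tail ω F h ih => simp only [eval, ih]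

theorem append_nil (F : PlanarForest Ω) : F.append nil = F := by
  induction F with
  | nil => rfl
  | cons ω F G _ ih => simp only [append, ih]

theorem append_assoc (F G H : PlanarForest Ω) :
    (F.append G).append H = F.append (G.append H) := by
  induction F with
  | nil => rfl
  | cons ω F K _ ih => simp only [append, ih]

theorem append_congr_right (F : PlanarForest Ω) {G G' : PlanarForest Ω} (h : Swap G G') :
    Swap (F.append G) (F.append G') := by
  induction F with
  | nil => exact h
  | cons ω F K _ ih => exact Swap.tail ω F ih

theorem append_congr_left {F F' : PlanarForest Ω} (G : PlanarForest Ω) (h : Swap F F') :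
    Swap (F.append G) (F'.append G) := by
  induction h with
  | swap => exact Swap.swap _ _ _ _ _
  | above ω H h ih => exact Swap.above ω _ h
  | tail ω F h ih => exact Swap.tail ω F ih

theorem eval_append {A : Type v} [CommMonoid A] (β : Ω → A → A) (F G : PlanarForest Ω) :
    (F.append G).eval β = F.eval β * G.eval β := by
  induction F with
  | nil => exact (one_mul _).symm
  | cons ω F K _ ih => simp only [append, eval, ih, mul_assoc]

end PlanarForest

/-- `Ω`-decorated rooted forests (non-planar: the trees of the forest, and the branches above each
vertex, are not ordered). -/
def Forest (Ω : Type u) : Type u := Quot (PlanarForest.Swap (Ω := Ω))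

namespace Forest

open PlanarForest

variable {Ω : Type u}

theorem mk_cons_congr (ω : Ω) (F : PlanarForest Ω) {G G' : PlanarForest Ω}
    (h : Quot.mk Swap G = Quot.mk Swap G') :
    Quot.mk Swap (cons ω F G) = Quot.mk Swap (cons ω F G') :=
  congrArg (Quot.map (cons ω F) fun _ _ => Swap.tail ω F) h

theorem mk_append_cons (F : PlanarForest Ω) (ω : Ω) (H G : PlanarForest Ω) :
    Quot.mk Swap (F.append (cons ω H G)) = Quot.mk Swap (cons ω H (F.append G)) := by
  induction F with
  | nil => rfl
  | cons ω' F K _ ih => exact (mk_cons_congr ω' F ih).trans (Quot.sound (Swap.swap _ _ _ _ _))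

theorem mk_append_comm (F G : PlanarForest Ω) :
    Quot.mk Swap (F.append G) = Quot.mk Swap (G.append F) := by
  induction F with
  | nil => exact congrArg _ (append_nil G).symm
  | cons ω F K _ ih => exact (mk_cons_congr ω F ih).trans (mk_append_cons G ω F K).symm

/-- Forests form a commutative monoid: `1` is the empty forest and the product is the
concatenation (disjoint union) of forests. -/
instance : CommMonoid (Forest Ω) where
  one := Quot.mk _ nil
  mul := Quot.map₂ append (fun F _ _ h => append_congr_right F h)
    (fun _ _ G h => append_congr_left G h)
  mul_assoc := by
    rintro ⟨F⟩ ⟨G⟩ ⟨H⟩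
    exact congrArg (Quot.mk _) (append_assoc F G H)
  one_mul := by
    rintro ⟨F⟩
    rfl
  mul_one := by
    rintro ⟨F⟩
    exact congrArg (Quot.mk _) (append_nil F)
  mul_comm := by
    rintro ⟨F⟩ ⟨G⟩
    exact mk_append_comm F G

/-- The grafting operator `B₊^ω`: the tree whose root is decorated by `ω` and linked to each root
of the given forest. -/
def graft (ω : Ω) : Forest Ω → Forest Ω :=
  Quot.map (fun F => cons ω F nil) fun _ _ h => Swap.above ω nil h

/-- The morphism from forests to a commutative monoid `A` operated by `Ω` through `β` that is given
by the universal property of forests. -/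
def lift {A : Type v} [CommMonoid A] (β : Ω → A → A) : Forest Ω →* A where
  toFun := Quot.lift (PlanarForest.eval β) fun _ _ h => eval_congr β h
  map_one' := rfl
  map_mul' := by
    rintro ⟨F⟩ ⟨G⟩
    exact eval_append β F G

theorem lift_graft {A : Type v} [CommMonoid A] (β : Ω → A → A) (ω : Ω) (F : Forest Ω) :
    lift β (graft ω F) = β ω (lift β F) := by
  obtain ⟨F⟩ := F
  exact mul_one _

theorem lift_unique {A : Type v} [CommMonoid A] (β : Ω → A → A) (φ : Forest Ω →* A)
    (hφ : ∀ ω F, φ (graft ω F) = β ω (φ F)) : φ = lift β := by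
  ext F
  obtain ⟨F⟩ := F
  induction F with
  | nil => exact φ.map_one
  | cons ω F G ihF ihG =>
    exact (φ.map_mul (graft ω (Quot.mk _ F)) (Quot.mk _ G)).trans
      (congrArg₂ (· * ·) ((hφ ω (Quot.mk _ F)).trans (congrArg (β ω) ihF)) ihG)

/-- The branching of a map `φ : A → A`:
`φ̂(∅) = 1`, `φ̂(F G) = φ̂(F) φ̂(G)`, `φ̂(B₊^a F) = φ(a φ̂(F))`. -/
def branching {A : Type v} [CommMonoid A] (φ : A → A) : Forest A →* A :=
  lift fun a b => φ (a * b)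

/-- The lifting of a map `f : Ω → Ω'` between decorations: it decorates by `f ω` the vertices that
were decorated by `ω`. -/
def lifting {Ω' : Type v} (f : Ω → Ω') : Forest Ω →* Forest Ω' :=
  lift fun ω F => graft (f ω) F

/-- The decorations of the roots, with multiplicity. -/
def roots : Forest Ω → Multiset Ω :=
  Quot.lift PlanarForest.roots fun _ _ h => roots_congr h

/-- The multiset, over all the vertices, of the number of direct successors of the vertex. -/
def outDegrees : Forest Ω → Multiset ℕ :=
  Quot.lift PlanarForest.outDegrees fun _ _ h => outDegrees_congr h

/-- Some vertex has strictly more than one direct successor. -/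
def HasBranchingVertex (F : Forest Ω) : Prop := ∃ d ∈ F.outDegrees, 1 < d

/-- The ladder tree `B₊^{ω₁} (⋯ (B₊^{ωₖ} ∅))` of a word `ω₁ ⋯ ωₖ` (the empty forest for the empty
word). -/
def ladder : List Ω → Forest Ω
  | [] => 1
  | ω :: w => graft ω (ladder w)

/-- A forest decorated by positive integers is convergent if each of its roots has a decoration
greater than or equal to `2`. -/
def IsConvergent (F : Forest ℕ+) : Prop := ∀ n ∈ F.roots, 2 ≤ n

end Forest

open Forest

noncomputable section

/-! Stuffle arborified zeta values -/

/-- The summation operator on real sequences: `u ↦ (N ↦ ∑_{1 ≤ n < N} u n)`. -/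
def summation (u : ℕ → ℝ) : ℕ → ℝ := fun N => ∑ n ∈ Finset.Ico 1 N, u n

/-- The sequence `k ↦ k^{-n}`. -/
def powerSeq (n : ℕ+) : ℕ → ℝ := fun k => ((k : ℝ) ^ (n : ℕ))⁻¹

/-- The truncated stuffle arborified zeta value: the branching of the summation operator, applied to
the forest whose decorations `n` are replaced by the sequences `k ↦ k^{-n}`. -/
def stuffleSum (F : Forest ℕ+) : ℕ → ℝ := branching summation (lifting powerSeq F)

/-- The stuffle arborified zeta value `lim_{N → ∞} stuffleSum F N`. -/
def zetaStuffle (F : Forest ℕ+) : ℝ := limUnder atTop (stuffleSum F)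

/-! Shuffle arborified zeta values -/

/-- The alphabet `{x, y}`. -/
inductive Letter : Type
  | x : Letter
  | y : Letter

/-- `σ_x(t) = 1 / t` and `σ_y(t) = 1 / (1 - t)`. -/
def letterForm : Letter → ℝ → ℝ
  | Letter.x => fun t => 1 / t
  | Letter.y => fun t => 1 / (1 - t)

/-- The integration operator `f ↦ (z ↦ ∫_ε^z f(t) dt)`. -/
def integration (ε : ℝ) (f : ℝ → ℝ) : ℝ → ℝ := fun z => ∫ t in ε..z, f t

/-- The arborified Chen integral from `ε` to `z` of a forest decorated by `{x, y}`: the branching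
of the integration operator, applied to the forest whose decorations are replaced by `σ_x, σ_y`. -/
def chenIntegral (F : Forest Letter) (ε z : ℝ) : ℝ :=
  branching (integration ε) (lifting letterForm F) z

/-- The arborified polylogarithm, for `0 < z < 1`: the limit of the arborified Chen integral from
`ε` to `z` as `ε → 0⁺`. -/
def arborifiedPolylog (F : Forest Letter) (z : ℝ) : ℝ :=
  limUnder (𝓝[>] (0 : ℝ)) fun ε => chenIntegral F ε z

/-- The shuffle arborified zeta value: the limit of the arborified polylogarithm as `z → 1⁻`. -/
def zetaShuffle (F : Forest Letter) : ℝ := limUnder (𝓝[<] (1 : ℝ)) (arborifiedPolylog F)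

/-- The branched binarisation map: the morphism with
`B₊^n F ↦ (B₊^x)^{n-1} (B₊^y (image of F))` for `n ≥ 1`. -/
def binarisation : Forest ℕ+ →* Forest Letter :=
  lift fun n F => (graft Letter.x)^[(n : ℕ) - 1] (graft Letter.y F)

end

end ArborifiedZeta

open ArborifiedZeta

namespace ArborifiedZeta

open MeasureTheory

/-! The polylogarithm of `binarisation F` is a power series with nonnegative coefficients
(`regularizesTo_chenIntegral_binarisation`). Multiplying by `1 / (1 - t)` replaces coefficients by
their partial sums, and each integration, whether against `1 / t` or `1 / (1 - t)`, divides the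
coefficient of `t ^ m` by `m`. Hence under grafting the partial sums of the coefficients obey the
same recursion as the truncated stuffle sums.

The two differ on products only: the partial sum of a Cauchy product runs over the triangle `i + j <
N`, the product of the partial sums over the square `i, j < N`. This gives
`partialSum_polylogSeries_le_stuffleSum`. Coefficients of nonempty forests are eventually positive,
so a product of two nonempty forests makes the inequality strict for large `N`
(`eventually_partialSum_polylogSeries_lt`).

Truncated stuffle sums grow at most like a power of the logarithm, so a root decoration at least `2`
makes both series converge, and Abel's theorem identifies the shuffle value of a tree with the sum
of its coefficients. A product at the top level costs nothing, since both limits are multiplicative;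
a product above a vertex enters through its truncations, and the gap survives in the sum. So
branching vertices are exactly what breaks equality. -/

/-! ### Power series with nonnegative coefficients -/

theorem summable_mul_pow_of_le {a : ℕ → ℝ} (ha : ∀ m, 0 ≤ a m) {s t : ℝ} (hs : 0 ≤ s)
    (hst : s ≤ t) (h : Summable fun m => a m * t ^ m) : Summable fun m => a m * s ^ m :=
  h.of_nonneg_of_le (fun m => mul_nonneg (ha m) (pow_nonneg hs m))
    fun m => mul_le_mul_of_nonneg_left (pow_le_pow_left₀ hs hst m) (ha m)

theorem continuousOn_tsum_mul_pow {a : ℕ → ℝ} (ha : ∀ m, 0 ≤ a m) {z : ℝ}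
    (h : Summable fun m => a m * z ^ m) :
    ContinuousOn (fun t => ∑' m, a m * t ^ m) (Set.Icc 0 z) := by
  refine continuousOn_tsum (fun m => by fun_prop) h fun m t ht => ?_
  rw [Real.norm_of_nonneg (mul_nonneg (ha m) (pow_nonneg ht.1 m))]
  exact mul_le_mul_of_nonneg_left (pow_le_pow_left₀ ht.1 ht.2 m) (ha m)

/-- Termwise integration of a power series with nonnegative coefficients. -/
theorem hasSum_integral_tsum_mul_pow {b : ℕ → ℝ} (hb : ∀ m, 0 ≤ b m) {z : ℝ} (hz : 0 ≤ z)
    (h : Summable fun m => b m * z ^ m) :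
    HasSum (fun m => b m / (m + 1 : ℝ) * z ^ (m + 1)) (∫ t in (0 : ℝ)..z, ∑' m, b m * t ^ m) := by
  have key := intervalIntegral.hasSum_integral_of_dominated_convergence (a := (0 : ℝ)) (b := z)
    (μ := volume) (F := fun m t => b m * t ^ m) (f := fun t => ∑' m, b m * t ^ m)
    (fun m _ => b m * z ^ m)
    (fun m => (by fun_prop : Continuous fun t : ℝ => b m * t ^ m).aestronglyMeasurable)
    (fun m => ae_of_all _ fun t ht => ?_) (ae_of_all _ fun t _ => h)
    intervalIntegrable_const (ae_of_all _ fun t ht => ?_)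
  · refine key.congr_fun fun m => ?_
    rw [intervalIntegral.integral_const_mul, integral_pow]
    simp
    ring
  · rw [Set.uIoc_of_le hz] at ht
    rw [Real.norm_of_nonneg (mul_nonneg (hb m) (pow_nonneg ht.1.le m))]
    exact mul_le_mul_of_nonneg_left (pow_le_pow_left₀ ht.1.le ht.2 m) (hb m)
  · rw [Set.uIoc_of_le hz] at ht
    exact (summable_mul_pow_of_le hb ht.1.le ht.2 h).hasSum

/-! ### Regularisation at the base point `0` -/

/-- The functions `I ε` on `[ε, 1)` increase to the power series with nonnegative coefficients `a`
as the base point `ε` tends to `0`. -/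
structure RegularizesTo (I : ℝ → ℝ → ℝ) (a : ℕ → ℝ) : Prop where
  nonneg : ∀ m, 0 ≤ a m
  summable : ∀ t ∈ Set.Ioo (0 : ℝ) 1, Summable fun m => a m * t ^ m
  continuousOn : ∀ ε ∈ Set.Ioo (0 : ℝ) 1, ContinuousOn (I ε) (Set.Ico ε 1)
  I_nonneg : ∀ ε ∈ Set.Ioo (0 : ℝ) 1, ∀ t ∈ Set.Ico ε 1, 0 ≤ I ε t
  I_le : ∀ ε ∈ Set.Ioo (0 : ℝ) 1, ∀ t ∈ Set.Ico ε 1, I ε t ≤ ∑' m, a m * t ^ m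
  tendsto : ∀ t ∈ Set.Ioo (0 : ℝ) 1,
    Tendsto (fun ε => I ε t) (𝓝[>] 0) (𝓝 (∑' m, a m * t ^ m))

namespace RegularizesTo

variable {I J : ℝ → ℝ → ℝ} {a b : ℕ → ℝ}

theorem one : RegularizesTo (fun _ => 1) fun m => if m = 0 then 1 else 0 := by
  have h : ∀ t : ℝ, (fun m : ℕ => (if m = 0 then (1 : ℝ) else 0) * t ^ m) =
      fun m => if m = 0 then 1 else 0 := by
    intro t
    ext m
    by_cases hm : m = 0 <;> simp [hm]
  refine ⟨fun m => by split_ifs <;> norm_num, fun t _ => ?_, fun ε _ => continuousOn_const,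
    fun _ _ _ _ => zero_le_one, fun _ _ t _ => ?_, fun t _ => ?_⟩
  · rw [h]
    exact (hasSum_ite_eq 0 (1 : ℝ)).summable
  · rw [h, tsum_ite_eq]
    rfl
  · rw [h, tsum_ite_eq]
    exact tendsto_const_nhds

theorem norm_summable (hI : RegularizesTo I a) {t : ℝ} (ht : t ∈ Set.Ioo (0 : ℝ) 1) :
    Summable fun m => ‖a m * t ^ m‖ :=
  (hI.summable t ht).congr fun m =>
    (Real.norm_of_nonneg (mul_nonneg (hI.nonneg m) (pow_nonneg ht.1.le m))).symm

theorem sum_antidiagonal_mul_pow (a b : ℕ → ℝ) (t : ℝ) (m : ℕ) :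
    ∑ p ∈ Finset.HasAntidiagonal.antidiagonal m, a p.1 * t ^ p.1 * (b p.2 * t ^ p.2) =
      (∑ p ∈ Finset.HasAntidiagonal.antidiagonal m, a p.1 * b p.2) * t ^ m := by
  rw [Finset.sum_mul]
  refine Finset.sum_congr rfl fun p hp => ?_
  rw [← Finset.HasAntidiagonal.mem_antidiagonal.1 hp, pow_add]
  ring

/-- Nonnegative series converge absolutely on `(0, 1)`, so their product is the Cauchy product. -/
theorem mul (hI : RegularizesTo I a) (hJ : RegularizesTo J b) :
    RegularizesTo (fun ε => I ε * J ε)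
      fun m => ∑ p ∈ Finset.HasAntidiagonal.antidiagonal m, a p.1 * b p.2 := by
  have hs : ∀ t ∈ Set.Ioo (0 : ℝ) 1,
      Summable fun m => (∑ p ∈ Finset.HasAntidiagonal.antidiagonal m, a p.1 * b p.2) * t ^ m := by
    intro t ht
    refine (summable_norm_sum_mul_antidiagonal_of_summable_norm (hI.norm_summable ht)
      (hJ.norm_summable ht)).of_norm.congr fun m => ?_
    exact sum_antidiagonal_mul_pow a b t m
  have hp : ∀ t ∈ Set.Ioo (0 : ℝ) 1,
      ∑' m, (∑ p ∈ Finset.HasAntidiagonal.antidiagonal m, a p.1 * b p.2) * t ^ m =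
        (∑' m, a m * t ^ m) * ∑' m, b m * t ^ m := by
    intro t ht
    rw [tsum_mul_tsum_eq_tsum_sum_antidiagonal_of_summable_norm (hI.norm_summable ht)
      (hJ.norm_summable ht)]
    exact tsum_congr fun m => (sum_antidiagonal_mul_pow a b t m).symm
  have hpos : ∀ ε ∈ Set.Ioo (0 : ℝ) 1, ∀ t ∈ Set.Ico ε 1, t ∈ Set.Ioo (0 : ℝ) 1 :=
    fun ε hε t ht => ⟨hε.1.trans_le ht.1, ht.2⟩
  refine ⟨fun m => Finset.sum_nonneg fun p _ => mul_nonneg (hI.nonneg _) (hJ.nonneg _), hs,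
    fun ε hε => (hI.continuousOn ε hε).mul (hJ.continuousOn ε hε),
    fun ε hε t ht => mul_nonneg (hI.I_nonneg ε hε t ht) (hJ.I_nonneg ε hε t ht),
    fun ε hε t ht => ?_, fun t ht => ?_⟩
  · rw [hp t (hpos ε hε t ht)]
    exact mul_le_mul (hI.I_le ε hε t ht) (hJ.I_le ε hε t ht) (hJ.I_nonneg ε hε t ht)
      ((hI.I_nonneg ε hε t ht).trans (hI.I_le ε hε t ht))
  · rw [hp t ht]
    exact (hI.tendsto t ht).mul (hJ.tendsto t ht)

/-- Integration against a weight `σ`, if the product of `σ` and the power series `a` is the power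
series `b`. -/
theorem integration (hI : RegularizesTo I a) {σ : ℝ → ℝ}
    (hσ : ContinuousOn σ (Set.Ioo 0 1)) (hσ0 : ∀ t ∈ Set.Ioo (0 : ℝ) 1, 0 ≤ σ t)
    (hb : ∀ m, 0 ≤ b m)
    (hab : ∀ t ∈ Set.Ioo (0 : ℝ) 1,
      HasSum (fun m => b m * t ^ m) (σ t * ∑' m, a m * t ^ m))
    {c : ℕ → ℝ} (hc0 : c 0 = 0) (hc : ∀ m : ℕ, c (m + 1) = b m / (m + 1)) :
    RegularizesTo (fun ε => integration ε (σ * I ε)) c := by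
  have hsub : ∀ ε ∈ Set.Ioo (0 : ℝ) 1, Set.Ico ε 1 ⊆ Set.Ioo (0 : ℝ) 1 :=
    fun ε hε t ht => ⟨hε.1.trans_le ht.1, ht.2⟩
  have hcn : ∀ m, 0 ≤ c m := by
    rintro (_ | m)
    · exact hc0.ge
    · rw [hc]
      exact div_nonneg (hb m) (by positivity)
  set g : ℝ → ℝ := fun t => ∑' m, b m * t ^ m with hg
  have hgeq : ∀ t ∈ Set.Ioo (0 : ℝ) 1, σ t * ∑' m, a m * t ^ m = g t :=
    fun t ht => (hab t ht).tsum_eq.symm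
  have hsum : ∀ z ∈ Set.Ioo (0 : ℝ) 1,
      HasSum (fun m => c m * z ^ m) (∫ t in (0 : ℝ)..z, g t) := by
    intro z hz
    have h := hasSum_integral_tsum_mul_pow hb hz.1.le (hab z hz).summable
    rw [← hasSum_nat_add_iff' 1]
    simpa [hc0, hc] using h
  have hgc : ∀ z ∈ Set.Ioo (0 : ℝ) 1, ContinuousOn g (Set.Icc 0 z) := fun z hz =>
    continuousOn_tsum_mul_pow hb (hab z hz).summable
  have hgi : ∀ z ∈ Set.Ioo (0 : ℝ) 1, IntervalIntegrable g volume 0 z := fun z hz =>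
    (hgc z hz).intervalIntegrable_of_Icc hz.1.le
  have hg0 : ∀ t, 0 ≤ t → 0 ≤ g t := fun t ht =>
    tsum_nonneg fun m => mul_nonneg (hb m) (pow_nonneg ht m)
  have hhc : ∀ ε ∈ Set.Ioo (0 : ℝ) 1, ContinuousOn (σ * I ε) (Set.Ico ε 1) := fun ε hε =>
    (hσ.mono (hsub ε hε)).mul (hI.continuousOn ε hε)
  have hIcc : ∀ (ε : ℝ), ∀ z ∈ Set.Ico ε 1, Set.Icc ε z ⊆ Set.Ico ε 1 := fun ε z hz t ht =>
    ⟨ht.1, ht.2.trans_lt hz.2⟩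
  have hh0 : ∀ ε ∈ Set.Ioo (0 : ℝ) 1, ∀ t ∈ Set.Ico ε 1, 0 ≤ (σ * I ε) t := fun ε hε t ht =>
    mul_nonneg (hσ0 t (hsub ε hε ht)) (hI.I_nonneg ε hε t ht)
  have hhg : ∀ ε ∈ Set.Ioo (0 : ℝ) 1, ∀ t ∈ Set.Ico ε 1, (σ * I ε) t ≤ g t := fun ε hε t ht =>
    (mul_le_mul_of_nonneg_left (hI.I_le ε hε t ht) (hσ0 t (hsub ε hε ht))).trans_eq
      (hgeq t (hsub ε hε ht))
  refine ⟨hcn, fun t ht => (hsum t ht).summable, fun ε hε z hz => ?_, fun ε hε z hz => ?_,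
    fun ε hε z hz => ?_, fun z hz => ?_⟩
  -- A point `w` strictly beyond `z` makes `[ε, w]` a neighbourhood of `z` within `[ε, 1)`.
  · obtain ⟨w, hw, hw1⟩ := exists_between hz.2
    have hεw : ε ≤ w := hz.1.trans hw.le
    have h1 : ContinuousOn (fun x => ∫ t in ε..x, (σ * I ε) t) (Set.uIcc ε w) := by
      apply intervalIntegral.continuousOn_primitive_interval
      rw [Set.uIcc_of_le hεw]
      exact ((hhc ε hε).mono (hIcc ε w ⟨hεw, hw1⟩)).integrableOn_Icc
    rw [Set.uIcc_of_le hεw] at h1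
    refine (h1 z ⟨hz.1, hw.le⟩).mono_of_mem_nhdsWithin ?_
    filter_upwards [self_mem_nhdsWithin, mem_nhdsWithin_of_mem_nhds (Iio_mem_nhds hw)]
      with t ht ht'
    exact ⟨ht.1, ht'.le⟩
  · exact intervalIntegral.integral_nonneg hz.1 fun t ht => hh0 ε hε t (hIcc ε z hz ht)
  · rw [(hsum z (hsub ε hε hz)).tsum_eq]
    have hgz := hgi z (hsub ε hε hz)
    calc ∫ t in ε..z, (σ * I ε) t ≤ ∫ t in ε..z, g t := by
          refine intervalIntegral.integral_mono_on hz.1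
            (((hhc ε hε).mono (hIcc ε z hz)).intervalIntegrable_of_Icc hz.1)
            (((hgc z (hsub ε hε hz)).mono (Set.Icc_subset_Icc_left hε.1.le)).intervalIntegrable_of_Icc
              hz.1) fun t ht => hhg ε hε t (hIcc ε z hz ht)
      _ ≤ ∫ t in (0 : ℝ)..z, g t := by
          refine intervalIntegral.integral_mono_interval hε.1.le hz.1 le_rfl ?_ hgz
          exact (ae_restrict_iff' measurableSet_Ioc).2 (ae_of_all _ fun t ht => hg0 t ht.1.le)
  · rw [(hsum z hz).tsum_eq]
    have hz' : Set.uIoc 0 z = Set.Ioc 0 z := Set.uIoc_of_le hz.1.le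
    have hev : ∀ᶠ ε in 𝓝[>] (0 : ℝ), ε ∈ Set.Ioo 0 z := Ioo_mem_nhdsGT hz.1
    -- Extending the integrand by zero below `ε` fixes the interval `[0, z]`; the limit `g` itself
    -- dominates.
    have key := intervalIntegral.tendsto_integral_filter_of_dominated_convergence
      (l := 𝓝[>] (0 : ℝ)) (μ := volume) (a := 0) (b := z) (f := g)
      (F := fun ε => (Set.Ioi ε).indicator (σ * I ε)) g ?_ ?_ (hgi z hz) ?_
    · refine key.congr' ?_
      filter_upwards [hev] with ε hε
      rw [intervalIntegral.integral_of_le hz.1.le, setIntegral_indicator measurableSet_Ioi,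
        Set.Ioc_inter_Ioi, max_eq_right hε.1.le, ← intervalIntegral.integral_of_le hε.2.le]
      rfl
    · filter_upwards [hev] with ε hε
      rw [aestronglyMeasurable_indicator_iff measurableSet_Ioi,
        Measure.restrict_restrict measurableSet_Ioi, hz', Set.inter_comm, Set.Ioc_inter_Ioi,
        max_eq_right hε.1.le]
      refine ContinuousOn.aestronglyMeasurable ?_ measurableSet_Ioc
      exact (hhc ε ⟨hε.1, hε.2.trans hz.2⟩).mono fun t ht => ⟨ht.1.le, ht.2.trans_lt hz.2⟩
    · filter_upwards [hev] with ε hε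
      refine ae_of_all _ fun t ht => ?_
      rw [hz'] at ht
      have hε1 : ε ∈ Set.Ioo (0 : ℝ) 1 := ⟨hε.1, hε.2.trans hz.2⟩
      by_cases h : t ∈ Set.Ioi ε
      · have ht' : t ∈ Set.Ico ε 1 := ⟨le_of_lt h, ht.2.trans_lt hz.2⟩
        rw [Set.indicator_of_mem h, Real.norm_of_nonneg (hh0 ε hε1 t ht')]
        exact hhg ε hε1 t ht'
      · rw [Set.indicator_of_notMem h, norm_zero]
        exact hg0 t ht.1.le
    · refine ae_of_all _ fun t ht => ?_
      rw [hz'] at ht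
      have ht1 : t ∈ Set.Ioo (0 : ℝ) 1 := ⟨ht.1, ht.2.trans_lt hz.2⟩
      rw [← hgeq t ht1]
      refine ((hI.tendsto t ht1).const_mul (σ t)).congr' ?_
      filter_upwards [Ioo_mem_nhdsGT ht.1] with ε hε
      rw [Set.indicator_of_mem (Set.mem_Ioi.2 hε.2)]
      rfl

/-- The vanishing constant term absorbs the pole of `1 / t`. In degree `0`, `a 0 / 0 = 0` is the
right coefficient. -/
theorem integration_x (hI : RegularizesTo I a) (ha : a 0 = 0) :
    RegularizesTo (fun ε => ArborifiedZeta.integration ε (letterForm Letter.x * I ε))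
      fun m => a m / m := by
  refine hI.integration (b := fun m => a (m + 1)) ?_ (fun t ht => ?_) (fun m => hI.nonneg _)
    (fun t ht => ?_) (by simp) (fun m => by push_cast; rfl)
  · exact continuousOn_const.div continuousOn_id fun t ht => ht.1.ne'
  · exact one_div_nonneg.2 ht.1.le
  · have h := (hasSum_nat_add_iff' 1).2 (hI.summable t ht).hasSum
    simp only [Finset.range_one, Finset.sum_singleton, ha, zero_mul, sub_zero] at h
    refine (h.mul_left (1 / t)).congr_fun fun m => ?_
    have := ht.1.ne'
    field_simp
    ring

/-- Multiplication by the geometric series produces the partial sums. The new constant term is `0`,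
which allows later integrations against `1 / t`. -/
theorem integration_y (hI : RegularizesTo I a) :
    RegularizesTo (fun ε => ArborifiedZeta.integration ε (letterForm Letter.y * I ε))
      fun m => (∑ j ∈ Finset.range m, a j) / m := by
  refine hI.integration (b := fun m => ∑ j ∈ Finset.range (m + 1), a j) ?_ (fun t ht => ?_)
    (fun m => Finset.sum_nonneg fun j _ => hI.nonneg j)
    (fun t ht => ?_) (by simp) (fun m => by push_cast; rfl)
  · exact continuousOn_const.div (by fun_prop) fun t ht => (sub_pos.2 ht.2).ne'
  · exact one_div_nonneg.2 (sub_pos.2 ht.2).le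
  · have hgeo : Summable fun m => ‖t ^ m‖ := by
      simpa [abs_of_pos ht.1] using summable_geometric_of_lt_one ht.1.le ht.2
    have heq : ∀ m, ∑ p ∈ Finset.HasAntidiagonal.antidiagonal m, a p.1 * t ^ p.1 * t ^ p.2 =
        (∑ j ∈ Finset.range (m + 1), a j) * t ^ m := by
      intro m
      rw [Finset.Nat.sum_antidiagonal_eq_sum_range_succ (fun i j => a i * t ^ i * t ^ j),
        Finset.sum_mul]
      refine Finset.sum_congr rfl fun j hj => ?_
      rw [mul_assoc, ← pow_add, Nat.add_sub_cancel' (Finset.mem_range_succ_iff.1 hj)]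
    have h1 := tsum_mul_tsum_eq_tsum_sum_antidiagonal_of_summable_norm (hI.norm_summable ht) hgeo
    have h2 := (summable_norm_sum_mul_antidiagonal_of_summable_norm (hI.norm_summable ht)
      hgeo).of_norm
    simp only [heq] at h1 h2
    rw [tsum_geometric_of_lt_one ht.1.le ht.2] at h1
    have : letterForm Letter.y t * ∑' m, a m * t ^ m =
        ∑' m, (∑ j ∈ Finset.range (m + 1), a j) * t ^ m := by
      rw [← h1, mul_comm]
      simp [letterForm]
    rw [this]
    exact h2.hasSum

end RegularizesTo

end ArborifiedZeta

namespace ArborifiedZeta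

open Forest

universe u

/-! ### Forests without branching vertices -/

namespace Forest

variable {Ω : Type u}

@[elab_as_elim]
theorem induction {P : Forest Ω → Prop} (one : P 1)
    (graft_mul : ∀ ω F G, P F → P G → P (graft ω F * G)) (F : Forest Ω) : P F := by
  obtain ⟨F⟩ := F
  induction F with
  | nil => exact one
  | cons ω F G ihF ihG => exact graft_mul ω (Quot.mk _ F) (Quot.mk _ G) ihF ihG

@[simp] theorem roots_one : (1 : Forest Ω).roots = 0 := rfl

@[simp] theorem outDegrees_one : (1 : Forest Ω).outDegrees = 0 := rfl

@[simp] theorem roots_graft_mul (ω : Ω) (F G : Forest Ω) :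
    (graft ω F * G).roots = ω ::ₘ G.roots := by
  obtain ⟨F⟩ := F
  obtain ⟨G⟩ := G
  rfl

@[simp] theorem outDegrees_graft_mul (ω : Ω) (F G : Forest Ω) :
    (graft ω F * G).outDegrees = F.roots.card ::ₘ (F.outDegrees + G.outDegrees) := by
  obtain ⟨F⟩ := F
  obtain ⟨G⟩ := G
  rfl

@[simp] theorem roots_graft (ω : Ω) (F : Forest Ω) : (graft ω F).roots = {ω} := by
  simpa using roots_graft_mul ω F 1

theorem not_hasBranchingVertex_one : ¬ (1 : Forest Ω).HasBranchingVertex := by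
  simp [HasBranchingVertex]

theorem hasBranchingVertex_graft_mul (ω : Ω) (F G : Forest Ω) :
    (graft ω F * G).HasBranchingVertex ↔
      (1 < F.roots.card ∨ F.HasBranchingVertex) ∨ G.HasBranchingVertex := by
  simp only [HasBranchingVertex, outDegrees_graft_mul, Multiset.mem_cons, Multiset.mem_add,
    or_and_right, exists_or, exists_eq_left, or_assoc]

theorem card_roots_ladder (w : List Ω) : (ladder w).roots.card ≤ 1 := by
  cases w with
  | nil => simp [ladder]
  | cons ω w => simp [ladder]

theorem not_hasBranchingVertex_ladder (w : List Ω) : ¬ (ladder w).HasBranchingVertex := by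
  induction w with
  | nil => exact not_hasBranchingVertex_one
  | cons ω w ih =>
    rw [ladder, ← mul_one (graft ω _), hasBranchingVertex_graft_mul]
    simp [ih, not_hasBranchingVertex_one, (card_roots_ladder w)]

theorem eq_one_of_card_roots {F : Forest Ω} (h : F.roots.card = 0) : F = 1 := by
  induction F using Forest.induction with
  | one => rfl
  | graft_mul ω F G _ _ => simp at h

/-- Below the bound on out-degrees, the forest above the root has at most one root, so the induction
runs along a single path. -/
theorem exists_eq_ladder {F : Forest Ω} (h1 : F.roots.card ≤ 1) (h : ¬ F.HasBranchingVertex) :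
    ∃ w, F = ladder w := by
  induction F using Forest.induction with
  | one => exact ⟨[], rfl⟩
  | graft_mul ω F G ihF _ =>
    rw [hasBranchingVertex_graft_mul] at h
    push Not at h
    obtain ⟨w, rfl⟩ := ihF h.1.1 h.1.2
    obtain rfl : G = 1 := eq_one_of_card_roots (by simpa using h1)
    exact ⟨ω :: w, mul_one _⟩

theorem not_hasBranchingVertex_iff (F : Forest Ω) :
    ¬ F.HasBranchingVertex ↔ ∃ ws : Multiset (List Ω), F = (ws.map ladder).prod := by
  constructor
  · intro h
    induction F using Forest.induction with
    | one => exact ⟨0, rfl⟩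
    | graft_mul ω F G _ ihG =>
      rw [hasBranchingVertex_graft_mul] at h
      push Not at h
      obtain ⟨w, rfl⟩ := exists_eq_ladder h.1.1 h.1.2
      obtain ⟨ws, rfl⟩ := ihG h.2
      exact ⟨(ω :: w) ::ₘ ws, by simp [ladder]⟩
  · rintro ⟨ws, rfl⟩
    induction ws using Multiset.induction with
    | empty => exact not_hasBranchingVertex_one
    | cons w ws ih =>
      rw [Multiset.map_cons, Multiset.prod_cons]
      cases w with
      -- The empty word contributes the factor `1`.
      | nil => simpa [ladder] using ih
      | cons ω w =>
        rw [ladder, hasBranchingVertex_graft_mul]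
        simp [ih, not_hasBranchingVertex_ladder, card_roots_ladder]

end Forest

/-! Recursion formulas -/

theorem stuffleSum_one : stuffleSum 1 = 1 := by simp [stuffleSum]

theorem stuffleSum_mul (F G : Forest ℕ+) : stuffleSum (F * G) = stuffleSum F * stuffleSum G := by
  simp [stuffleSum]

theorem stuffleSum_graft (n : ℕ+) (F : Forest ℕ+) :
    stuffleSum (graft n F) = summation (powerSeq n * stuffleSum F) := by
  simp [stuffleSum, lifting, branching, lift_graft]

/-- The index `0` may be included because division by `0 ^ n` gives `0`; this matches the shape of
`partialSum_polylogSeries_graft`. -/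
theorem stuffleSum_graft_apply (n : ℕ+) (F : Forest ℕ+) (N : ℕ) :
    stuffleSum (graft n F) N = ∑ m ∈ Finset.range N, stuffleSum F m / (m : ℝ) ^ (n : ℕ) := by
  rw [stuffleSum_graft, summation]
  cases N with
  | zero => simp
  | succ N =>
    rw [Finset.range_eq_Ico, Finset.sum_eq_sum_Ico_succ_bot N.succ_pos]
    simp [powerSeq, div_eq_inv_mul]

theorem chenIntegral_one (ε : ℝ) : chenIntegral 1 ε = 1 := by
  ext z
  simp [chenIntegral]

theorem chenIntegral_mul (F G : Forest Letter) (ε : ℝ) :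
    chenIntegral (F * G) ε = chenIntegral F ε * chenIntegral G ε := by
  ext z
  simp [chenIntegral]

theorem chenIntegral_graft (a : Letter) (F : Forest Letter) (ε : ℝ) :
    chenIntegral (graft a F) ε = integration ε (letterForm a * chenIntegral F ε) := by
  ext z
  simp only [chenIntegral, lifting, branching, lift_graft]
  rfl

theorem binarisation_graft (n : ℕ+) (F : Forest ℕ+) :
    binarisation (graft n F) = (graft Letter.x)^[(n : ℕ) - 1] (graft Letter.y (binarisation F)) :=
  lift_graft _ _ _

/-! Power series coefficients of the polylogarithm of a binarised forest -/

/-- The sum of the coefficients of degree less than `N`. -/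
noncomputable def partialSum (f : PowerSeries ℝ) (N : ℕ) : ℝ := ∑ j ∈ Finset.range N, f.coeff j

/-- The power series expansion of the arborified polylogarithm of a binarised forest. -/
noncomputable def polylogSeries : Forest ℕ+ →* PowerSeries ℝ :=
  lift fun n f => PowerSeries.mk fun m => partialSum f m / (m : ℝ) ^ (n : ℕ)

theorem coeff_polylogSeries_graft (n : ℕ+) (F : Forest ℕ+) (m : ℕ) :
    (polylogSeries (graft n F)).coeff m = partialSum (polylogSeries F) m / (m : ℝ) ^ (n : ℕ) := by
  rw [polylogSeries, lift_graft, PowerSeries.coeff_mk]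

theorem partialSum_polylogSeries_graft (n : ℕ+) (F : Forest ℕ+) (N : ℕ) :
    partialSum (polylogSeries (graft n F)) N =
      ∑ m ∈ Finset.range N, partialSum (polylogSeries F) m / (m : ℝ) ^ (n : ℕ) :=
  Finset.sum_congr rfl fun m _ => coeff_polylogSeries_graft n F m

theorem regularizesTo_iterate_x {F : Forest Letter} {a : ℕ → ℝ}
    (h : RegularizesTo (chenIntegral F) a) (ha : a 0 = 0) (k : ℕ) :
    RegularizesTo (chenIntegral ((graft Letter.x)^[k] F)) fun m => a m / (m : ℝ) ^ k := by
  induction k with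
  | zero => simpa using h
  | succ k ih =>
    rw [Function.iterate_succ_apply']
    have := ih.integration_x (by simp [ha])
    simp only [← chenIntegral_graft] at this
    simpa [pow_succ, div_div] using this

theorem regularizesTo_chenIntegral_binarisation (F : Forest ℕ+) :
    RegularizesTo (chenIntegral (binarisation F)) fun m => (polylogSeries F).coeff m := by
  induction F using Forest.induction with
  | one =>
    have h : chenIntegral (binarisation 1) = fun _ => 1 := by
      ext1 ε
      rw [map_one, chenIntegral_one]
    rw [h, map_one]
    simpa only [PowerSeries.coeff_one] using RegularizesTo.one
  | graft_mul n F G ihF ihG =>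
    have hy := ihF.integration_y
    simp only [← chenIntegral_graft] at hy
    have hT := regularizesTo_iterate_x hy (by simp) ((n : ℕ) - 1)
    rw [← binarisation_graft] at hT
    have hmul := hT.mul ihG
    simp only [← chenIntegral_mul, ← map_mul] at hmul
    -- The letter `y` supplies one factor `1 / m`, the `n - 1` letters `x` the others.
    have hc : ∀ m, (polylogSeries (graft n F)).coeff m =
        (∑ j ∈ Finset.range m, (polylogSeries F).coeff j) / m / (m : ℝ) ^ ((n : ℕ) - 1) := by
      intro m
      rw [coeff_polylogSeries_graft, div_div, ← pow_succ', Nat.sub_add_cancel n.pos, partialSum]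
    simp only [← hc, ← PowerSeries.coeff_mul, ← map_mul] at hmul
    exact hmul

theorem coeff_polylogSeries_nonneg (F : Forest ℕ+) (m : ℕ) : 0 ≤ (polylogSeries F).coeff m :=
  (regularizesTo_chenIntegral_binarisation F).nonneg m

theorem partialSum_polylogSeries_nonneg (F : Forest ℕ+) (N : ℕ) :
    0 ≤ partialSum (polylogSeries F) N :=
  Finset.sum_nonneg fun m _ => coeff_polylogSeries_nonneg F m

/-! Comparison of the partial sums -/

theorem partialSum_one {N : ℕ} (hN : 0 < N) : partialSum 1 N = 1 := by
  simp [partialSum, PowerSeries.coeff_one, hN]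

theorem partialSum_mul (f g : PowerSeries ℝ) (N : ℕ) :
    partialSum (f * g) N =
      ∑ p ∈ (Finset.range N ×ˢ Finset.range N) with p.1 + p.2 < N, f.coeff p.1 * g.coeff p.2 := by
  simp only [partialSum, PowerSeries.coeff_mul]
  rw [Finset.sum_sigma']
  refine Finset.sum_bij' (fun x _ => x.2) (fun p _ => ⟨p.1 + p.2, p⟩) ?_ ?_ ?_ ?_ ?_
  · rintro ⟨m, i, j⟩ h
    simp only [Finset.mem_sigma, Finset.mem_range, Finset.HasAntidiagonal.mem_antidiagonal] at h
    simp only [Finset.mem_filter, Finset.mem_product, Finset.mem_range]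
    omega
  · rintro ⟨i, j⟩ h
    simp only [Finset.mem_filter, Finset.mem_product, Finset.mem_range] at h
    simpa using h.2
  · rintro ⟨m, i, j⟩ h
    simp only [Finset.mem_sigma, Finset.mem_range, Finset.HasAntidiagonal.mem_antidiagonal] at h
    obtain ⟨_, rfl⟩ := h
    rfl
  · intros
    rfl
  · intros
    rfl

theorem partialSum_mul_partialSum (f g : PowerSeries ℝ) (N : ℕ) :
    partialSum f N * partialSum g N =
      ∑ p ∈ Finset.range N ×ˢ Finset.range N, f.coeff p.1 * g.coeff p.2 := by
  rw [partialSum, partialSum, Finset.sum_mul_sum, Finset.sum_product]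

/-- The triangle `i + j < N` lies in the square, and all terms are nonnegative. -/
theorem partialSum_mul_le {f g : PowerSeries ℝ} (hf : ∀ m, 0 ≤ f.coeff m)
    (hg : ∀ m, 0 ≤ g.coeff m) (N : ℕ) :
    partialSum (f * g) N ≤ partialSum f N * partialSum g N := by
  rw [partialSum_mul, partialSum_mul_partialSum]
  exact Finset.sum_le_sum_of_subset_of_nonneg (Finset.filter_subset _ _)
    fun p _ _ => mul_nonneg (hf _) (hg _)

theorem partialSum_mul_lt {f g : PowerSeries ℝ} (hf : ∀ m, 0 ≤ f.coeff m)
    (hg : ∀ m, 0 ≤ g.coeff m) {i j N : ℕ} (hi : i < N) (hj : j < N) (hij : N ≤ i + j)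
    (hfi : 0 < f.coeff i) (hgj : 0 < g.coeff j) :
    partialSum (f * g) N < partialSum f N * partialSum g N := by
  rw [partialSum_mul, partialSum_mul_partialSum]
  refine Finset.sum_lt_sum_of_subset (Finset.filter_subset _ _) (i := (i, j)) (by simp [hi, hj])
    (by simp [hij]) (mul_pos hfi hgj) fun p _ _ => mul_nonneg (hf _) (hg _)

theorem stuffleSum_nonneg (F : Forest ℕ+) (N : ℕ) : 0 ≤ stuffleSum F N := by
  induction F using Forest.induction generalizing N with
  | one => simp [stuffleSum_one]
  | graft_mul n F G ihF ihG =>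
    rw [stuffleSum_mul, Pi.mul_apply, stuffleSum_graft_apply]
    exact mul_nonneg (Finset.sum_nonneg fun m _ => div_nonneg (ihF m) (by positivity)) (ihG N)

theorem partialSum_polylogSeries_le_stuffleSum (F : Forest ℕ+) (N : ℕ) :
    partialSum (polylogSeries F) N ≤ stuffleSum F N := by
  induction F using Forest.induction generalizing N with
  | one =>
    rcases N.eq_zero_or_pos with rfl | hN
    · simp [partialSum, stuffleSum_one]
    · simp [partialSum_one hN, stuffleSum_one]
  | graft_mul n F G ihF ihG =>
    rw [stuffleSum_mul, Pi.mul_apply, map_mul]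
    refine (partialSum_mul_le (coeff_polylogSeries_nonneg _) (coeff_polylogSeries_nonneg _) N).trans
      (mul_le_mul ?_ (ihG N) (partialSum_polylogSeries_nonneg _ _) (stuffleSum_nonneg _ _))
    rw [partialSum_polylogSeries_graft, stuffleSum_graft_apply]
    gcongr with m hm
    exact ihF m

theorem eventually_partialSum_pos_of_coeff_pos {f : PowerSeries ℝ} (hf : ∀ m, 0 ≤ f.coeff m)
    {j : ℕ} (hj : 0 < f.coeff j) : ∀ᶠ N in atTop, 0 < partialSum f N := by
  filter_upwards [eventually_gt_atTop j] with N hN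
  exact hj.trans_le (Finset.single_le_sum (f := fun j => f.coeff j) (fun m _ => hf m)
    (Finset.mem_range.2 hN))

/-- The two claims are proved together: the series of the empty forest has a single positive
coefficient, and one positive coefficient of `F` and of `G` is all that the induction step uses. -/
theorem exists_coeff_polylogSeries_pos_and (F : Forest ℕ+) :
    (∃ j, 0 < (polylogSeries F).coeff j) ∧
      (F ≠ 1 → ∀ᶠ m in atTop, 0 < (polylogSeries F).coeff m) := by
  induction F using Forest.induction with
  | one => exact ⟨⟨0, by simp⟩, fun h => (h rfl).elim⟩
  | graft_mul n F G ihF ihG =>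
    suffices h : ∀ᶠ m in atTop, 0 < (polylogSeries (graft n F * G)).coeff m from
      ⟨h.exists, fun _ => h⟩
    obtain ⟨i, hi⟩ := ihF.1
    obtain ⟨j, hj⟩ := ihG.1
    have hT : ∀ᶠ m in atTop, 0 < (polylogSeries (graft n F)).coeff m := by
      filter_upwards [eventually_partialSum_pos_of_coeff_pos (coeff_polylogSeries_nonneg F) hi,
        eventually_gt_atTop 0] with m hm hm0
      rw [coeff_polylogSeries_graft]
      positivity
    filter_upwards [(tendsto_sub_atTop_nat j).eventually hT, eventually_ge_atTop j] with m hm hjm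
    rw [map_mul, PowerSeries.coeff_mul]
    -- The fixed degree `j` of `G` pairs with `m - j`, which is large when `m` is.
    refine Finset.sum_pos' (fun p _ => mul_nonneg (coeff_polylogSeries_nonneg _ _)
      (coeff_polylogSeries_nonneg _ _)) ⟨(m - j, j), ?_, mul_pos hm hj⟩
    simp [Nat.sub_add_cancel hjm]

theorem eventually_coeff_polylogSeries_pos {F : Forest ℕ+} (hF : F ≠ 1) :
    ∀ᶠ m in atTop, 0 < (polylogSeries F).coeff m :=
  (exists_coeff_polylogSeries_pos_and F).2 hF

/-- Without products the recursions coincide. `N = 0` is excluded since for the empty forest the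
values there are `0` and `1`; the term `m = 0` of the recursion vanishes anyway. -/
theorem partialSum_polylogSeries_ladder (w : List ℕ+) {N : ℕ} (hN : 0 < N) :
    partialSum (polylogSeries (ladder w)) N = stuffleSum (ladder w) N := by
  induction w generalizing N with
  | nil => simp [ladder, partialSum_one hN, stuffleSum_one]
  | cons n w ih =>
    rw [ladder, partialSum_polylogSeries_graft, stuffleSum_graft_apply]
    refine Finset.sum_congr rfl fun m _ => ?_
    rcases m.eq_zero_or_pos with rfl | hm
    · simp
    · rw [ih hm]

/-- The corner `(N - 1, N - 1)` of the square is outside the triangle once `N ≥ 2`. -/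
theorem eventually_partialSum_mul_polylogSeries_lt {F G : Forest ℕ+} (hF : F ≠ 1) (hG : G ≠ 1) :
    ∀ᶠ N in atTop, partialSum (polylogSeries (F * G)) N <
      partialSum (polylogSeries F) N * partialSum (polylogSeries G) N := by
  filter_upwards [(tendsto_sub_atTop_nat 1).eventually (eventually_coeff_polylogSeries_pos hF),
    (tendsto_sub_atTop_nat 1).eventually (eventually_coeff_polylogSeries_pos hG),
    eventually_ge_atTop 2] with N h1 h2 hN
  rw [map_mul]
  exact partialSum_mul_lt (coeff_polylogSeries_nonneg _) (coeff_polylogSeries_nonneg _)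
    (by omega) (by omega) (by omega) h1 h2

theorem graft_ne_one (n : ℕ+) (F : Forest ℕ+) : graft n F ≠ 1 := fun h => by
  simpa using congrArg Forest.roots h

/-- Several roots suffice here, unlike for the limits: this is what a vertex grafted below the
forest sees. -/
theorem eventually_partialSum_polylogSeries_lt {F : Forest ℕ+}
    (hF : 1 < F.roots.card ∨ F.HasBranchingVertex) :
    ∀ᶠ N in atTop, partialSum (polylogSeries F) N < stuffleSum F N := by
  induction F using Forest.induction with
  | one => simp [not_hasBranchingVertex_one] at hF
  | graft_mul n F G ihF ihG =>
    by_cases hG : G = 1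
    · subst hG
      rw [hasBranchingVertex_graft_mul] at hF
      simp only [roots_graft_mul, roots_one, Multiset.card_cons, Multiset.card_zero,
        not_hasBranchingVertex_one, or_false, zero_add, lt_irrefl, false_or] at hF
      obtain ⟨M, hM⟩ := eventually_atTop.1 (ihF hF)
      filter_upwards [eventually_gt_atTop (M + 1)] with N hN
      rw [mul_one, partialSum_polylogSeries_graft, stuffleSum_graft_apply]
      -- One strict term is enough; `M + 1` rather than `M` keeps the denominator nonzero.
      refine Finset.sum_lt_sum (fun m _ => ?_) ⟨M + 1, Finset.mem_range.2 hN, ?_⟩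
      · gcongr
        exact partialSum_polylogSeries_le_stuffleSum F m
      · gcongr
        exact hM _ (by omega)
    · filter_upwards [eventually_partialSum_mul_polylogSeries_lt (graft_ne_one n F) hG] with N hN
      rw [stuffleSum_mul]
      exact hN.trans_le (mul_le_mul (partialSum_polylogSeries_le_stuffleSum _ N)
        (partialSum_polylogSeries_le_stuffleSum _ N) (partialSum_polylogSeries_nonneg _ _)
        (stuffleSum_nonneg _ _))

/-! Convergence -/

/-- Each vertex costs at most a harmonic sum, so the exponent built here counts the vertices. -/
theorem exists_stuffleSum_le_log_pow (F : Forest ℕ+) :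
    ∃ k : ℕ, ∀ N : ℕ, stuffleSum F N ≤ (2 + Real.log N) ^ k := by
  have hlog : ∀ N : ℕ, 0 ≤ Real.log N := Real.log_natCast_nonneg
  induction F using Forest.induction with
  | one => exact ⟨0, fun N => by simp [stuffleSum_one]⟩
  | graft_mul n F G ihF ihG =>
    obtain ⟨k, hk⟩ := ihF
    obtain ⟨l, hl⟩ := ihG
    refine ⟨1 + k + l, fun N => ?_⟩
    have hN := hlog N
    rw [stuffleSum_mul, Pi.mul_apply, pow_add]
    refine mul_le_mul ?_ (hl N) (stuffleSum_nonneg _ _) (by positivity)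
    rw [stuffleSum_graft, summation, pow_add, pow_one]
    calc ∑ m ∈ Finset.Ico 1 N, (powerSeq n * stuffleSum F) m
        ≤ ∑ m ∈ Finset.Ico 1 N, (m : ℝ)⁻¹ * (2 + Real.log N) ^ k := by
          refine Finset.sum_le_sum fun m hm => ?_
          have hm' := Finset.mem_Ico.1 hm
          have hm1 : (1 : ℝ) ≤ m := by exact_mod_cast hm'.1
          rw [Pi.mul_apply, powerSeq]
          have h1 : stuffleSum F m ≤ (2 + Real.log N) ^ k := by
            refine (hk m).trans ?_
            have := hlog m
            gcongr
            exact hm'.2.le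
          have h2 : ((m : ℝ) ^ (n : ℕ))⁻¹ ≤ (m : ℝ)⁻¹ :=
            inv_anti₀ (by positivity) (le_self_pow₀ hm1 n.ne_zero)
          exact mul_le_mul h2 h1 (stuffleSum_nonneg _ _) (by positivity)
      _ = (∑ m ∈ Finset.Ico 1 N, (m : ℝ)⁻¹) * (2 + Real.log N) ^ k := by rw [Finset.sum_mul]
      _ ≤ (2 + Real.log N) * (2 + Real.log N) ^ k := by
          gcongr
          calc ∑ m ∈ Finset.Ico 1 N, (m : ℝ)⁻¹ ≤ ∑ m ∈ Finset.Icc 1 N, (m : ℝ)⁻¹ :=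
                Finset.sum_le_sum_of_subset_of_nonneg
                  (fun m hm => by simp only [Finset.mem_Ico, Finset.mem_Icc] at hm ⊢; omega)
                  fun m _ _ => by positivity
            _ = (harmonic N : ℝ) := by
                rw [harmonic_eq_sum_Icc]
                push_cast
                rfl
            _ ≤ 1 + Real.log N := harmonic_le_one_add_log N
            _ ≤ 2 + Real.log N := by linarith

/-- The exponent `1 / (2 * (k + 1))` keeps the `k`-th power below `x ^ (1 / 2)`, which leaves the
summable `x ^ (-3 / 2)`. -/
theorem summable_log_pow_div_sq (k : ℕ) :
    Summable fun m : ℕ => (2 + Real.log m) ^ k / (m : ℝ) ^ 2 := by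
  have hs : (0 : ℝ) < 1 / (2 * (k + 1)) := by positivity
  have h1 : (fun x : ℝ => 2 + Real.log x) =O[atTop] fun x => x ^ ((1 : ℝ) / (2 * (k + 1))) :=
    ((Asymptotics.isLittleO_const_left.2 (Or.inr (tendsto_norm_atTop_atTop.comp
      (tendsto_rpow_atTop hs)))).add (isLittleO_log_rpow_atTop hs)).isBigO
  have h2 : (fun x : ℝ => (2 + Real.log x) ^ k / x ^ 2) =O[atTop] fun x => (x ^ (3 / 2 : ℝ))⁻¹ := by
    have h3 := (h1.pow k).mul (Asymptotics.isBigO_refl (fun x : ℝ => (x ^ 2)⁻¹) atTop)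
    simp only [← div_eq_mul_inv] at h3
    refine h3.trans (Asymptotics.IsBigO.of_bound 1 ?_)
    filter_upwards [eventually_ge_atTop 1] with x hx
    have hx0 : 0 < x := by linarith
    rw [Real.norm_of_nonneg (by positivity), Real.norm_of_nonneg (by positivity), one_mul,
      ← Real.rpow_natCast, ← Real.rpow_mul hx0.le, ← Real.rpow_natCast, ← Real.rpow_sub hx0,
      ← Real.rpow_neg hx0.le]
    refine Real.rpow_le_rpow_of_exponent_le hx ?_
    have : (1 : ℝ) / (2 * (k + 1)) * k ≤ 1 / 2 := by
      rw [div_mul_eq_mul_div, div_le_div_iff₀ (by positivity) (by positivity)]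
      linarith
    push_cast
    linarith
  exact summable_of_isBigO_nat (Real.summable_nat_rpow_inv.2 (by norm_num))
    (h2.comp_tendsto tendsto_natCast_atTop_atTop)

theorem summable_stuffleSum_div_pow (F : Forest ℕ+) {n : ℕ} (hn : 2 ≤ n) :
    Summable fun m : ℕ => stuffleSum F m / (m : ℝ) ^ n := by
  obtain ⟨k, hk⟩ := exists_stuffleSum_le_log_pow F
  refine (summable_log_pow_div_sq k).of_nonneg_of_le
    (fun m => div_nonneg (stuffleSum_nonneg F m) (by positivity)) fun m => ?_
  rcases m.eq_zero_or_pos with rfl | hm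
  · simp [show n ≠ 0 by omega]
  · have hm1 : (1 : ℝ) ≤ m := by exact_mod_cast hm
    have := Real.log_natCast_nonneg m
    exact div_le_div₀ (by positivity) (hk m) (by positivity) (pow_le_pow_right₀ hm1 hn)

theorem summable_coeff_polylogSeries_graft (F : Forest ℕ+) {n : ℕ+} (hn : 2 ≤ n) :
    Summable fun m => (polylogSeries (graft n F)).coeff m :=
  (summable_stuffleSum_div_pow F (n := n) hn).of_nonneg_of_le
    (coeff_polylogSeries_nonneg _) fun m => by
      rw [coeff_polylogSeries_graft]
      gcongr
      exact partialSum_polylogSeries_le_stuffleSum F m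

/-! ### Limits at `1` and the case of equality -/

/-- The value at `t` of the power series of the arborified polylogarithm. -/
noncomputable def polylogValue (F : Forest ℕ+) (t : ℝ) : ℝ :=
  ∑' m, (polylogSeries F).coeff m * t ^ m

theorem tendsto_chenIntegral_binarisation (F : Forest ℕ+) {z : ℝ} (hz : z ∈ Set.Ioo (0 : ℝ) 1) :
    Tendsto (fun ε => chenIntegral (binarisation F) ε z) (𝓝[>] 0) (𝓝 (polylogValue F z)) :=
  (regularizesTo_chenIntegral_binarisation F).tendsto z hz

theorem polylogValue_mul (F G : Forest ℕ+) {z : ℝ} (hz : z ∈ Set.Ioo (0 : ℝ) 1) :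
    polylogValue (F * G) z = polylogValue F z * polylogValue G z := by
  refine tendsto_nhds_unique (tendsto_chenIntegral_binarisation (F * G) hz) ?_
  simp only [map_mul, chenIntegral_mul]
  exact (tendsto_chenIntegral_binarisation F hz).mul (tendsto_chenIntegral_binarisation G hz)

theorem arborifiedPolylog_binarisation (F : Forest ℕ+) {z : ℝ} (hz : z ∈ Set.Ioo (0 : ℝ) 1) :
    arborifiedPolylog (binarisation F) z = polylogValue F z :=
  (tendsto_chenIntegral_binarisation F hz).limUnder_eq

/-- Both values are sums of series compared term by term, so they agree exactly when no term is
strict. The forest above the root contributes through all its truncations, hence the condition on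
its number of roots. -/
theorem exists_limits_graft {n : ℕ+} (hn : 2 ≤ n) (F : Forest ℕ+) :
    ∃ S Z : ℝ, Tendsto (stuffleSum (graft n F)) atTop (𝓝 Z) ∧
      Tendsto (polylogValue (graft n F)) (𝓝[<] 1) (𝓝 S) ∧ 0 < S ∧ S ≤ Z ∧
      (S = Z ↔ ¬ (1 < F.roots.card ∨ F.HasBranchingVertex)) := by
  have hZ := summable_stuffleSum_div_pow F (n := n) hn
  have hS := summable_coeff_polylogSeries_graft F hn
  have hle : ∀ m, (polylogSeries (graft n F)).coeff m ≤ stuffleSum F m / (m : ℝ) ^ (n : ℕ) := by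
    intro m
    rw [coeff_polylogSeries_graft]
    gcongr
    exact partialSum_polylogSeries_le_stuffleSum F m
  refine ⟨_, _, ?_, Real.tendsto_tsum_powerSeries_nhdsWithin_lt hS.hasSum.tendsto_sum_nat, ?_,
    hS.tsum_le_tsum hle hZ, ⟨fun h hF => ?_, fun h => ?_⟩⟩
  · exact hZ.hasSum.tendsto_sum_nat.congr fun N => (stuffleSum_graft_apply n F N).symm
  · obtain ⟨m, hm⟩ := (exists_coeff_polylogSeries_pos_and (graft n F)).1
    exact hS.tsum_pos (coeff_polylogSeries_nonneg _) m hm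
  · obtain ⟨m, hm, hm0⟩ := ((eventually_partialSum_polylogSeries_lt hF).and
      (eventually_gt_atTop 0)).exists
    refine (Summable.tsum_lt_tsum hle (i := m) ?_ hS hZ).ne h
    rw [coeff_polylogSeries_graft]
    gcongr
  · push Not at h
    obtain ⟨w, rfl⟩ := exists_eq_ladder h.1 h.2
    refine tsum_congr fun m => ?_
    rw [coeff_polylogSeries_graft]
    rcases m.eq_zero_or_pos with rfl | hm
    · simp
    · rw [partialSum_polylogSeries_ladder w hm]

theorem exists_limits {F : Forest ℕ+} (hF : F.IsConvergent) :
    ∃ S Z : ℝ, Tendsto (stuffleSum F) atTop (𝓝 Z) ∧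
      Tendsto (polylogValue F) (𝓝[<] 1) (𝓝 S) ∧ 0 < S ∧ S ≤ Z ∧
      (S = Z ↔ ¬ F.HasBranchingVertex) := by
  have hev : ∀ᶠ z in 𝓝[<] (1 : ℝ), z ∈ Set.Ioo (0 : ℝ) 1 := Ioo_mem_nhdsLT zero_lt_one
  induction F using Forest.induction with
  | one =>
    refine ⟨1, 1, ?_, ?_, one_pos, le_rfl, by simp [not_hasBranchingVertex_one]⟩
    · rw [stuffleSum_one]
      exact tendsto_const_nhds
    · refine tendsto_const_nhds.congr fun z => ?_
      rw [polylogValue, map_one, tsum_eq_single 0 fun m hm => by simp [PowerSeries.coeff_one, hm]]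
      simp
  | graft_mul n F G _ ihG =>
    simp only [IsConvergent, roots_graft_mul, Multiset.mem_cons, forall_eq_or_imp] at hF
    obtain ⟨S₁, Z₁, hZ₁, hS₁, hpos₁, hle₁, hiff₁⟩ := exists_limits_graft hF.1 F
    obtain ⟨S₂, Z₂, hZ₂, hS₂, hpos₂, hle₂, hiff₂⟩ := ihG hF.2
    refine ⟨S₁ * S₂, Z₁ * Z₂, ?_, ?_, mul_pos hpos₁ hpos₂,
      mul_le_mul hle₁ hle₂ hpos₂.le (hpos₁.le.trans hle₁), ?_⟩
    · rw [stuffleSum_mul]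
      exact hZ₁.mul hZ₂
    · refine (hS₁.mul hS₂).congr' ?_
      filter_upwards [hev] with z hz
      exact (polylogValue_mul _ _ hz).symm
    -- Positivity of the factors turns equality of the products into equality for each factor.
    · rw [mul_eq_mul_iff_eq_and_eq_of_pos hle₁ hle₂ hpos₁ (hpos₂.trans_le hle₂), hiff₁, hiff₂,
        hasBranchingVertex_graft_mul]
      exact not_or.symm

end ArborifiedZeta

theorem theorem5 (F : Forest ℕ+) (hF : F.IsConvergent) :
    -- the limits that define the two zeta values exist
    Tendsto (stuffleSum F) atTop (𝓝 (zetaStuffle F)) ∧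
    (∀ z ∈ Set.Ioo (0 : ℝ) 1,
      Tendsto (fun ε => chenIntegral (binarisation F) ε z) (𝓝[>] (0 : ℝ))
        (𝓝 (arborifiedPolylog (binarisation F) z))) ∧
    Tendsto (arborifiedPolylog (binarisation F)) (𝓝[<] (1 : ℝ))
      (𝓝 (zetaShuffle (binarisation F))) ∧
    -- the inequality, and its case of equality
    zetaShuffle (binarisation F) ≤ zetaStuffle F ∧
    (zetaShuffle (binarisation F) = zetaStuffle F ↔ ¬ F.HasBranchingVertex) ∧
    -- absence of branching vertices means: empty, or a product of ladder trees
    (¬ F.HasBranchingVertex ↔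
      ∃ ws : Multiset (List ℕ+), F = (ws.map Forest.ladder).prod) := by
  obtain ⟨S, Z, hZ, hS, -, hle, hiff⟩ := exists_limits hF
  have hS' : Tendsto (arborifiedPolylog (binarisation F)) (𝓝[<] 1) (𝓝 S) := by
    refine hS.congr' ?_
    filter_upwards [Ioo_mem_nhdsLT (zero_lt_one (α := ℝ))] with z hz
    exact (arborifiedPolylog_binarisation F hz).symm
  have hzS : zetaShuffle (binarisation F) = S := hS'.limUnder_eq
  have hzZ : zetaStuffle F = Z := hZ.limUnder_eq
  rw [hzS, hzZ]
  refine ⟨hZ, fun z hz => ?_, hS', hle, hiff, Forest.not_hasBranchingVertex_iff F⟩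
  rw [arborifiedPolylog_binarisation F hz]
  exact tendsto_chenIntegral_binarisation F hz
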